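/- Identify $\mathbb R^2$ with $\mathbb C$, let $\mathcal H^1$ be one-dimensional Hausdorff measure, and call $M\subset\mathbb R^2$ countably $1$-rectifiable if $M\subset M_0\cup\bigcup_{j\ge 1}G_j(\mathbb R)$ with $\mathcal H^1(M_0)=0$ and Lipschitz maps $G_j:\mathbb R\to\mathbb R^2$. **Construction.** Let $A_{0,1}$ be a nondegenerate line segment from $a$ to $b$ in $\mathbb R^2$, and let $0\le\varepsilon<1/100$. Let $T_{0,1}$ be the (closed, filled) isosceles triangle with base $A_{0,1}$ and height $\varepsilon|b-a|$, on either side of the base, and let $\theta_{0,1}=\arctan(2\varepsilon)$ be its base angle. Inductively, given isosceles triangles $T_{n,i}$ over segments $A_{n,i}$ ($1\le i\le 2^n$) with base angles $\theta_{n,i}$, label their $2^{n+1}$ shorter sides $A_{n+1,1},\dots,A_{n+1,2^{n+1}}$ consecutively from $a$ to $b$, so that $A_{n+1,2i-1},A_{n+1,2i}$ are the sides of $T_{n,i}$; over each $A_{n+1,k}$ take the isosceles triangle $T_{n+1,k}$ with base $A_{n+1,k}$ lying inside the previous triangle, with base angles satisfying $0\le\theta_{n+1,2i-1}\le\theta_{n,i}$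 and $0\le\theta_{n+1,2i}\le\theta_{n,i}$, and otherwise arbitrary (angle $0$ is allowed and gives a degenerate triangle, namely the base itself, whose two "shorter sides" are the halves of the base). Let $B=\bigcap_{n\ge0}\bigcup_{i=1}^{2^n}T_{n,i}$ and let $E$ be the set of all vertices of all triangles $T_{n,i}$. A set $A\in\{B,\,B\setminus E\}$ is called a *Koch type set*; it is called an *$A_\varepsilon$-type set* if moreover $\theta_{n,i}$ depends only on $n$. Let $F_n:A_{0,1}\to\mathbb R^2$ map the $i$-th of the $2^n$ dyadic subintervals of order $n$ of the base $A_{0,1}$ (counted from $a$) affinely onto $A_{n,i}$, preserving the order from $a$ to $b$, and let $\mathcal F=\lim_n F_n$ (pointwise; the limit exists). For $x\in A$ let $i(n,x)$ be the index $i$ with $x\in T_{n,i}$ (the larger one if $x$ is a common vertex of two consecutive triangles), and put $$\Lambda_\infty=\Big\{x\in A:\ \prod_{n=0}^{\infty}\big(\cos\theta_{n,i(n,x)}\big)^{-1}=\infty\Big\},\qquad \Lambda_\infty^{-1}=\mathcal F^{-1}(\Lambda_\infty)\subset A_{0,1}.$$ **Theorem.** Let $A$ be a Koch type set. 1. If $\mathcal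 H^1(\Lambda_\infty)=0$, then $A$ is countably $1$-rectifiable. 2. If $\mathcal H^1(\Lambda_\infty^{-1})>0$, then $A$ is not countably $1$-rectifiable. 3. If $A$ is an $A_\varepsilon$-type set, then $A$ is countably $1$-rectifiable if and only if $\mathcal H^1(\Lambda_\infty^{-1})=0$. -/

import Mathlib

open Set Filter Topology MeasureTheory
open scoped MeasureTheory

noncomputable section

/-- A subset `M` of the Euclidean plane (written as `ℂ`) is countably `1`-rectifiable if it is
covered by an `ℋ¹`-null set and countably many Lipschitz images of the line. -/
def CountablyOneRectifiable (M : Set ℂ) : Prop :=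
  ∃ (M₀ : Set ℂ) (F : ℕ → ℝ → ℂ),
    Measure.hausdorffMeasure 1 M₀ = 0 ∧
    (∀ j, ∃ C : NNReal, LipschitzWith C (F j)) ∧
    M ⊆ M₀ ∪ ⋃ j, range (F j)

/-- The free parameters of the construction of a Koch type set in the plane `ℂ`: a base segment
from `a` to `b`, the relative height `ε` of the first cap, and the base angles `θ n i` of the
caps `T n i`, where `n` is the level and `i < 2 ^ n` counts the caps of that level from `a` to
`b`, starting with `0` (the values with `2 ^ n ≤ i` are never used).  The caps inside
`T n i` are `T (n + 1) (2 * i)` and `T (n + 1) (2 * i + 1)`. -/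
structure KochConstruction where
  a : ℂ
  b : ℂ
  a_ne_b : a ≠ b
  ε : ℝ
  ε_nonneg : 0 ≤ ε
  ε_lt : ε < 1 / 100
  θ : ℕ → ℕ → ℝ
  /-- An isosceles triangle over a base of length `L` with height `ε * L` has base angles
  `arctan (2 * ε)`. -/
  θ_zero : θ 0 0 = Real.arctan (2 * ε)
  θ_nonneg : ∀ n i, i < 2 ^ n → 0 ≤ θ n i
  θ_left_le : ∀ n i, i < 2 ^ n → θ (n + 1) (2 * i) ≤ θ n i
  θ_right_le : ∀ n i, i < 2 ^ n → θ (n + 1) (2 * i + 1) ≤ θ n i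

namespace KochConstruction

/-- The apex of the isosceles triangle of level `n` with base angles `φ` over the segment from
`l` to `r`.  The first triangle lies to the left of the directed base.  Each new cap has to lie
inside the previous one, so the side alternates with the level (see `cap_subset`). -/
def capApex (n : ℕ) (φ : ℝ) (l r : ℂ) : ℂ :=
  (l + r) / 2 + (-1) ^ n * Complex.I * (r - l) * ((Real.tan φ / 2 : ℝ) : ℂ)

variable (K : KochConstruction)

/-- The two end points of the edge `A n i`, the one nearer to `a` along the curve first. -/
def edge : ℕ → ℕ → ℂ × ℂ
  | 0, _ => (K.a, K.b)
  | n + 1, i =>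
    let p := edge n (i / 2)
    let m := capApex n (K.θ n (i / 2)) p.1 p.2
    if i % 2 = 0 then (p.1, m) else (m, p.2)

/-- The new vertex of the cap `T n i`. -/
def apex (n i : ℕ) : ℂ := capApex n (K.θ n i) (K.edge n i).1 (K.edge n i).2

/-- The three vertices of the cap `T n i`. -/
def vertices (n i : ℕ) : Set ℂ := {(K.edge n i).1, (K.edge n i).2, K.apex n i}

/-- The (closed, filled) triangular cap `T n i` over the edge `A n i`. -/
def cap (n i : ℕ) : Set ℂ := convexHull ℝ (K.vertices n i)

/-- The set `B = ⋂ₙ ⋃ᵢ T n i`. -/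
def limitSet : Set ℂ := ⋂ n : ℕ, ⋃ i ∈ Finset.range (2 ^ n), K.cap n i

/-- The set of all edge points, i.e. of all vertices of the caps. -/
def edgePoints : Set ℂ := ⋃ n : ℕ, ⋃ i ∈ Finset.range (2 ^ n), K.vertices n i

/-- `A` is a Koch type set constructed from the parameters `K`. -/
def IsKochTypeSet (A : Set ℂ) : Prop :=
  A = K.limitSet ∨ A = K.limitSet \ K.edgePoints

/-- The parameters belong to an `A_ε`-type set: all base angles of one level agree. -/
def IsAEpsilonType : Prop :=
  ∀ n i j, i < 2 ^ n → j < 2 ^ n → K.θ n i = K.θ n j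

/-- The number of a dyadic interval of order `n` of `[0, 1]` that contains `t`. -/
def dyadicIndex (n : ℕ) (t : ℝ) : ℕ := min ⌊2 ^ n * t⌋₊ (2 ^ n - 1)

/-- The approximating map of level `n`: it maps the dyadic interval
`[i / 2 ^ n, (i + 1) / 2 ^ n]` affinely onto the edge `A n i`.  Here and in `kochMap` the
parameter `t ∈ [0, 1]` stands for the point `a + t (b - a)` of the base. -/
def approxMap (n : ℕ) (t : ℝ) : ℂ :=
  AffineMap.lineMap (K.edge n (dyadicIndex n t)).1 (K.edge n (dyadicIndex n t)).2
    (2 ^ n * t - dyadicIndex n t)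

/-- The map `𝓕` from the base onto the limit set, the pointwise limit of the approximating
maps (the limit exists, see `tendsto_approxMap`). -/
def kochMap (t : ℝ) : ℂ := limUnder atTop fun n => K.approxMap n t

open scoped Classical in
/-- The index `i(n, x)` of the cap of level `n` that contains `x`.  If `x` is an edge point that
lies in two neighbouring caps, it is the cap of which `x` is the left end point, i.e. the one with
the larger index. -/
def capIndex (n : ℕ) (x : ℂ) : ℕ := Nat.findGreatest (fun i => x ∈ K.cap n i) (2 ^ n - 1)

/-- The partial products of the stretch product `∏ₙ (cos θ_{n, i(n, x)})⁻¹`. -/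
def stretch (N : ℕ) (x : ℂ) : ℝ :=
  ∏ n ∈ Finset.range N, (Real.cos (K.θ n (K.capIndex n x)))⁻¹

/-- `Λ_∞`: the points of `A` at which the stretch product is infinite. -/
def lambdaInf (A : Set ℂ) : Set ℂ := {x ∈ A | Tendsto (fun N => K.stretch N x) atTop atTop}

/-- `Λ_∞⁻¹`: the preimage of `Λ_∞` under `𝓕`, a subset of the base segment from `a` to `b`. -/
def lambdaInfPreimage (A : Set ℂ) : Set ℂ :=
  AffineMap.lineMap K.a K.b '' {t : ℝ | t ∈ Icc (0 : ℝ) 1 ∧ K.kochMap t ∈ K.lambdaInf A}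

theorem θ_le (n i : ℕ) (hi : i < 2 ^ n) : K.θ n i ≤ Real.arctan (2 * K.ε) := by
  induction n generalizing i with
  | zero =>
    obtain rfl : i = 0 := by simpa using hi
    exact K.θ_zero.le
  | succ n ih =>
    have hj : i / 2 < 2 ^ n := by rw [pow_succ] at hi; omega
    refine le_trans ?_ (ih (i / 2) hj)
    rcases Nat.mod_two_eq_zero_or_one i with h | h
    · have := K.θ_left_le n (i / 2) hj
      rwa [show 2 * (i / 2) = i by omega] at this
    · have := K.θ_right_le n (i / 2) hj
      rwa [show 2 * (i / 2) + 1 = i by omega] at this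

theorem tan_bounds (n i : ℕ) (hi : i < 2 ^ n) :
    0 ≤ Real.tan (K.θ n i) ∧ Real.tan (K.θ n i) ≤ 1 / 50 := by
  have h0 := K.θ_nonneg n i hi
  have h1 := K.θ_le n i hi
  have h2 := Real.arctan_lt_pi_div_two (2 * K.ε)
  refine ⟨Real.tan_nonneg_of_nonneg_of_le_pi_div_two h0 (by linarith), ?_⟩
  have h3 : Real.tan (K.θ n i) ≤ Real.tan (Real.arctan (2 * K.ε)) := by
    rcases h1.lt_or_eq with h | h
    · exact (Real.tan_lt_tan_of_lt_of_lt_pi_div_two (by linarith [Real.pi_pos]) h2 h).le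
    · rw [h]
  rw [Real.tan_arctan] at h3
  linarith [K.ε_lt]

theorem tan_le_tan (n i : ℕ) (hi : i < 2 ^ (n + 1)) :
    Real.tan (K.θ (n + 1) i) ≤ Real.tan (K.θ n (i / 2)) := by
  have hj : i / 2 < 2 ^ n := by rw [pow_succ] at hi; omega
  have h0 := K.θ_nonneg (n + 1) i hi
  have h2 := (K.θ_le n (i / 2) hj).trans_lt (Real.arctan_lt_pi_div_two (2 * K.ε))
  have h1 : K.θ (n + 1) i ≤ K.θ n (i / 2) := by
    rcases Nat.mod_two_eq_zero_or_one i with h | h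
    · have := K.θ_left_le n (i / 2) hj
      rwa [show 2 * (i / 2) = i by omega] at this
    · have := K.θ_right_le n (i / 2) hj
      rwa [show 2 * (i / 2) + 1 = i by omega] at this
  rcases h1.lt_or_eq with h | h
  · exact (Real.tan_lt_tan_of_lt_of_lt_pi_div_two (by linarith [Real.pi_pos]) h2 h).le
  · rw [h]

theorem edge_succ_even (n i : ℕ) (h : i % 2 = 0) :
    K.edge (n + 1) i = ((K.edge n (i / 2)).1, K.apex n (i / 2)) := by
  simp [edge, apex, h]

theorem edge_succ_odd (n i : ℕ) (h : i % 2 = 1) :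
    K.edge (n + 1) i = (K.apex n (i / 2), (K.edge n (i / 2)).2) := by
  simp [edge, apex, h]

theorem mem_convexHull_triple {x y z w : ℂ} {p q r : ℝ} (hp : 0 ≤ p) (hq : 0 ≤ q) (hr : 0 ≤ r)
    (h : p + q + r = 1) (hw : w = p * x + q * y + r * z) :
    w ∈ convexHull ℝ ({x, y, z} : Set ℂ) := by
  have hx : x ∈ convexHull ℝ ({x, y, z} : Set ℂ) := subset_convexHull ℝ _ (by simp)
  have hy : y ∈ convexHull ℝ ({x, y, z} : Set ℂ) := subset_convexHull ℝ _ (by simp)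
  have hz : z ∈ convexHull ℝ ({x, y, z} : Set ℂ) := subset_convexHull ℝ _ (by simp)
  have := (convex_convexHull ℝ ({x, y, z} : Set ℂ)).sum_mem (t := Finset.univ)
    (w := ![p, q, r]) (z := ![x, y, z]) (by intro i _; fin_cases i <;> simpa)
    (by simp [Fin.sum_univ_three, h]) (by intro i _; fin_cases i <;> simpa)
  simpa [Fin.sum_univ_three, hw] using this

/-- Each new cap lies inside the previous one. -/
theorem cap_subset (n i : ℕ) (hi : i < 2 ^ (n + 1)) : K.cap (n + 1) i ⊆ K.cap n (i / 2) := by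
  have hj : i / 2 < 2 ^ n := by rw [pow_succ] at hi; omega
  obtain ⟨hs0, -⟩ := K.tan_bounds (n + 1) i hi
  obtain ⟨ht0, ht1⟩ := K.tan_bounds n (i / 2) hj
  have hst := K.tan_le_tan n i hi
  have hl : (K.edge n (i / 2)).1 ∈ K.cap n (i / 2) := subset_convexHull ℝ _ (by simp [vertices])
  have hr : (K.edge n (i / 2)).2 ∈ K.cap n (i / 2) := subset_convexHull ℝ _ (by simp [vertices])
  have hm : K.apex n (i / 2) ∈ K.cap n (i / 2) := subset_convexHull ℝ _ (by simp [vertices])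
  have hap : K.apex (n + 1) i ∈ K.cap n (i / 2) := by
    have key : ∃ u : ℝ, 0 ≤ u ∧ u ≤ 1 ∧
        Real.tan (K.θ (n + 1) i) = u * Real.tan (K.θ n (i / 2)) := by
      rcases ht0.eq_or_lt with h | h
      · exact ⟨0, le_rfl, zero_le_one, by linarith⟩
      · exact ⟨_ / _, div_nonneg hs0 h.le, (div_le_one h).2 hst, by field_simp⟩
    obtain ⟨u, hu0, hu1, hu⟩ := key
    set t := Real.tan (K.θ n (i / 2)) with ht
    have hsq : ((-1 : ℂ) ^ n) ^ 2 = 1 := by rw [← pow_mul, mul_comm, pow_mul]; simp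
    have hut : 0 ≤ u * t * t := by positivity
    have hut1 : u * t * t ≤ 1 := by nlinarith [mul_nonneg hu0 ht0]
    rcases Nat.mod_two_eq_zero_or_one i with h | h
    · refine mem_convexHull_triple (p := 1 / 2 + u / 4 - u * t * t / 4)
        (q := u * t * t / 4 + u / 4) (r := (1 - u) / 2) (by linarith) (by linarith) (by linarith)
        (by ring) ?_
      simp only [apex, K.edge_succ_even n i h, capApex, hu, ← ht]
      push_cast
      linear_combination (Complex.I ^ 2 * ((K.edge n (i / 2)).2 - (K.edge n (i / 2)).1) *
        (-u * t * t / 4)) * hsq + (-((K.edge n (i / 2)).2 - (K.edge n (i / 2)).1) *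
        (u * t * t / 4)) * Complex.I_sq
    · refine mem_convexHull_triple (p := u * t * t / 4 + u / 4)
        (q := 1 / 2 + u / 4 - u * t * t / 4) (r := (1 - u) / 2) (by linarith) (by linarith)
        (by linarith) (by ring) ?_
      simp only [apex, K.edge_succ_odd n i h, capApex, hu, ← ht]
      push_cast
      linear_combination (Complex.I ^ 2 * ((K.edge n (i / 2)).2 - (K.edge n (i / 2)).1) *
        (u * t * t / 4)) * hsq + (((K.edge n (i / 2)).2 - (K.edge n (i / 2)).1) *
        (u * t * t / 4)) * Complex.I_sq
  refine convexHull_min ?_ (convex_convexHull ℝ _)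
  rcases Nat.mod_two_eq_zero_or_one i with h | h
  · rw [vertices, K.edge_succ_even n i h]
    rintro x (rfl | rfl | rfl) <;> assumption
  · rw [vertices, K.edge_succ_odd n i h]
    rintro x (rfl | rfl | rfl) <;> assumption

theorem norm_edge_le (n i : ℕ) (hi : i < 2 ^ n) :
    ‖(K.edge n i).2 - (K.edge n i).1‖ ≤ ‖K.b - K.a‖ * (51 / 100) ^ n := by
  induction n generalizing i with
  | zero => simp [edge]
  | succ n ih =>
    have hj : i / 2 < 2 ^ n := by rw [pow_succ] at hi; omega
    obtain ⟨ht0, ht1⟩ := K.tan_bounds n (i / 2) hj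
    have hc : ∀ c : ℂ, ‖c‖ = 1 →
        ‖(1 / 2 + c * ((Real.tan (K.θ n (i / 2)) / 2 : ℝ) : ℂ))‖ ≤ 51 / 100 := by
      intro c hc
      refine (norm_add_le _ _).trans ?_
      rw [norm_mul, hc, Complex.norm_real, Real.norm_of_nonneg (by linarith)]
      norm_num
      linarith
    rw [pow_succ, ← mul_assoc]
    rcases Nat.mod_two_eq_zero_or_one i with h | h
    · rw [K.edge_succ_even n i h]
      have : K.apex n (i / 2) - (K.edge n (i / 2)).1 =
          ((K.edge n (i / 2)).2 - (K.edge n (i / 2)).1) *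
            (1 / 2 + ((-1) ^ n * Complex.I) * ((Real.tan (K.θ n (i / 2)) / 2 : ℝ) : ℂ)) := by
        simp only [apex, capApex]; ring
      simp only [this, norm_mul ((K.edge n (i / 2)).2 - _)]
      exact mul_le_mul (ih _ hj) (hc _ (by simp)) (norm_nonneg _) (by positivity)
    · rw [K.edge_succ_odd n i h]
      have : (K.edge n (i / 2)).2 - K.apex n (i / 2) =
          ((K.edge n (i / 2)).2 - (K.edge n (i / 2)).1) *
            (1 / 2 + (-((-1) ^ n * Complex.I)) * ((Real.tan (K.θ n (i / 2)) / 2 : ℝ) : ℂ)) := by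
        simp only [apex, capApex]; ring
      simp only [this, norm_mul ((K.edge n (i / 2)).2 - _)]
      exact mul_le_mul (ih _ hj) (hc _ (by simp)) (norm_nonneg _) (by positivity)

theorem dyadicIndex_lt (n : ℕ) (t : ℝ) : dyadicIndex n t < 2 ^ n := by
  have : 0 < 2 ^ n := by positivity
  unfold dyadicIndex; omega

theorem dyadicIndex_le (n : ℕ) {t : ℝ} (h0 : 0 ≤ t) : (dyadicIndex n t : ℝ) ≤ 2 ^ n * t :=
  le_trans (Nat.cast_le.2 (min_le_left _ _)) (Nat.floor_le (by positivity))

theorem le_dyadicIndex (n : ℕ) {t : ℝ} (h1 : t ≤ 1) : 2 ^ n * t ≤ dyadicIndex n t + 1 := by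
  have hp : (0 : ℝ) < 2 ^ n := by positivity
  have h2 : 2 ^ n * t ≤ (2 : ℝ) ^ n := by nlinarith
  have h3 := (Nat.lt_floor_add_one ((2 : ℝ) ^ n * t)).le
  unfold dyadicIndex
  rcases min_choice ⌊(2 : ℝ) ^ n * t⌋₊ (2 ^ n - 1) with h | h <;> rw [h]
  · exact h3
  · rw [Nat.cast_sub Nat.one_le_two_pow]; push_cast; linarith

theorem dyadicIndex_succ_div (n : ℕ) (t : ℝ) :
    dyadicIndex (n + 1) t / 2 = dyadicIndex n t := by
  have h : ⌊(2 : ℝ) ^ (n + 1) * t⌋₊ / 2 = ⌊(2 : ℝ) ^ n * t⌋₊ := by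
    rw [← Nat.floor_div_natCast]; congr 1; push_cast; ring
  have : 0 < 2 ^ n := by positivity
  unfold dyadicIndex
  rw [← h, pow_succ 2 n]
  omega

/-- The approximating maps converge on the whole base. -/
theorem tendsto_approxMap {t : ℝ} (h0 : 0 ≤ t) (h1 : t ≤ 1) :
    Tendsto (fun n => K.approxMap n t) atTop (𝓝 (K.kochMap t)) := by
  have hcauchy : CauchySeq fun n => K.approxMap n t := by
    refine cauchySeq_of_le_geometric (51 / 100) ‖K.b - K.a‖ (by norm_num) fun n => ?_
    have hj := dyadicIndex_lt n t
    have hdiv := dyadicIndex_succ_div n t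
    have hlo := dyadicIndex_le n h0
    have hup := le_dyadicIndex n h1
    have hlo' := dyadicIndex_le (n + 1) h0
    have hup' := le_dyadicIndex (n + 1) h1
    obtain ⟨ht0, ht1⟩ := K.tan_bounds n _ hj
    refine le_trans ?_ (K.norm_edge_le n _ hj)
    rw [dist_comm, dist_eq_norm]
    unfold approxMap
    set j := dyadicIndex n t
    set i := dyadicIndex (n + 1) t
    set τ := Real.tan (K.θ n j) with hτ
    have hfin : ∀ w : ℝ, 0 ≤ w → w ≤ 1 → ∀ x : ℂ,
        ‖(-1 : ℂ) ^ n * Complex.I * x * ((w * τ : ℝ) : ℂ)‖ ≤ ‖x‖ := by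
      intro w hw0 hw1 x
      rw [norm_mul, norm_mul, norm_mul, Complex.norm_real, Real.norm_of_nonneg (by positivity)]
      simp only [norm_pow, norm_neg, norm_one, one_pow, Complex.norm_I, one_mul]
      exact mul_le_of_le_one_right (norm_nonneg _) (by nlinarith)
    rcases Nat.mod_two_eq_zero_or_one i with h | h
    · have hi : i = 2 * j := by omega
      have hi' : (i : ℝ) = 2 * j := by exact_mod_cast hi
      rw [K.edge_succ_even n i h, hdiv]
      refine le_of_eq_of_le ?_ (hfin (2 ^ n * t - j) (by linarith) (by linarith) _)
      congr 1
      simp only [AffineMap.lineMap_apply, vsub_eq_sub, vadd_eq_add, Complex.real_smul, apex,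
        capApex, hi', ← hτ]
      push_cast
      ring
    · have hi : i = 2 * j + 1 := by omega
      have hi' : (i : ℝ) = 2 * j + 1 := by exact_mod_cast hi
      rw [K.edge_succ_odd n i h, hdiv]
      refine le_of_eq_of_le ?_ (hfin (1 - (2 ^ n * t - j)) (by linarith) (by linarith) _)
      congr 1
      simp only [AffineMap.lineMap_apply, vsub_eq_sub, vadd_eq_add, Complex.real_smul, apex,
        capApex, hi', ← hτ]
      push_cast
      ring
  exact hcauchy.tendsto_limUnder

end KochConstruction

end

/-!
Write `L = ‖b - a‖` and let `F` be the parametrization `kochMap` of the limit set.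

*Geometry.* All base angles are small, so in the complex coordinate in which its base is `[0, 1]`
every cap lies in the thin `rhombus`.  Hence the two caps inside a cap lie in nearly opposite
sectors with vertex at its apex.  Descending through the levels, neighbouring caps lie in opposite
sectors at their common vertex (`norm_add_norm_le_of_adjacent`), and caps of level `n` that are not
neighbours have distance at least `L / 5 / 2 ^ n` (`le_norm_sub_of_not_adjacent`).  Therefore `F` is
a bijection of `[0, 1]` onto the limit set with Lipschitz inverse (`dist_le_kochMap`,
`exists_kochMap_eq`), the cap index of `F t` is the dyadic index of `t` (`capIndex_kochMap`), and
the edge of level `n` below `F t` has length `L / 2 ^ n` times the `n`-th partial stretch product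
(`edgeLength_dyadicIndex`).

*Finite stretch gives rectifiability.* On the set of parameters with stretch product at most `M`,
the caps of level `n` have size at most `M * L / 2 ^ n`, so `F` is Lipschitz there
(`lipschitzOnWith_kochMap`) and extends to the line.  These countably many curves cover everything
but `Λ_∞`.

*Infinite stretch prevents it.* If `F` is Lipschitz on `D`, then at a density point `t` of `D` the
ends of the edge of level `n` below `F t` are nearly attained on `D` by parameters at distance at
most `2 ^ (-n)`; the edge thus has length `O(2 ^ (-n))` and the stretch product is finite
(`volume_stretch_atTop_eq_zero`).  Given a Lipschitz curve `G`, compose it with a Lipschitz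
extension `h` of the inverse of `F`.  By Rademacher's and Sard's theorems the line is, up to a set
with null image under `h ∘ G`, a countable union of sets on which `h ∘ G` has a Lipschitz inverse
(`LipschitzWith.exists_antilipschitzWith_restrict`), and `F` is Lipschitz on their images under
`h ∘ G`, as far as `G` takes values in the limit set there.  So `G` meets the image of the
parameters with infinite stretch in a set with null preimage.

If the angles depend on the level only, the stretch product is the same at all points; since
the preimage of `A` has full measure, `Λ_∞` is empty as soon as its preimage is null.
-/

/-! ### Geometry of a single cap -/

namespace KochConstruction

variable (K : KochConstruction)

/-- The thin rhombus over the unit segment `[0, 1] ⊆ ℂ` with slopes `± 1 / 50`.  It contains every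
cap, in the complex coordinate in which the base of the cap is `[0, 1]`, irrespective of the side
on which the cap lies. -/
def rhombus : Set ℂ := {w | |w.im| ≤ w.re / 50 ∧ |w.im| ≤ (1 - w.re) / 50}

theorem mem_rhombus_one_sub {w : ℂ} (hw : w ∈ rhombus) : 1 - w ∈ rhombus := by
  obtain ⟨h1, h2⟩ := hw
  constructor <;> simp only [Complex.sub_re, Complex.sub_im, Complex.one_re, Complex.one_im,
    zero_sub, abs_neg, sub_sub_cancel] <;> assumption

theorem convex_rhombus : Convex ℝ rhombus := by
  rintro x ⟨hx1, hx2⟩ y ⟨hy1, hy2⟩ a b ha hb hab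
  have him : |(a • x + b • y).im| ≤ a * |x.im| + b * |y.im| := by
    simp only [Complex.add_im, Complex.real_smul, Complex.im_ofReal_mul]
    refine (abs_add_le _ _).trans_eq ?_
    rw [abs_mul, abs_mul, abs_of_nonneg ha, abs_of_nonneg hb]
  have hre : (a • x + b • y).re = a * x.re + b * y.re := by simp
  have e1 := mul_le_mul_of_nonneg_left hx1 ha
  have e2 := mul_le_mul_of_nonneg_left hx2 ha
  have e3 := mul_le_mul_of_nonneg_left hy1 hb
  have e4 := mul_le_mul_of_nonneg_left hy2 hb
  refine ⟨him.trans ?_, him.trans ?_⟩ <;> rw [hre] <;> linarith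

/-- The length of the edge `A n i`. -/
noncomputable def edgeLength (n i : ℕ) : ℝ := ‖(K.edge n i).2 - (K.edge n i).1‖

theorem edgeLength_nonneg (n i : ℕ) : 0 ≤ K.edgeLength n i := norm_nonneg _

theorem apex_eq (n i : ℕ) (hi : i < 2 ^ n) : ∃ s : ℝ, |s| = Real.tan (K.θ n i) / 2 ∧
    K.apex n i = (K.edge n i).1 +
      ((K.edge n i).2 - (K.edge n i).1) * (1 / 2 + (s : ℂ) * Complex.I) := by
  refine ⟨(-1) ^ n * (Real.tan (K.θ n i) / 2), ?_, ?_⟩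
  · rw [abs_mul, abs_pow, abs_neg, abs_one, one_pow, one_mul,
      abs_of_nonneg (by linarith [(K.tan_bounds n i hi).1])]
  · simp only [apex, capApex]
    push_cast
    ring

theorem cap_subset_rhombus (n i : ℕ) (hi : i < 2 ^ n) {x : ℂ} (hx : x ∈ K.cap n i) :
    ∃ w ∈ rhombus, x = (K.edge n i).1 + ((K.edge n i).2 - (K.edge n i).1) * w := by
  obtain ⟨ht0, ht1⟩ := K.tan_bounds n i hi
  have hconv : Convex ℝ {x : ℂ | ∃ w ∈ rhombus,
      x = (K.edge n i).1 + ((K.edge n i).2 - (K.edge n i).1) * w} := by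
    rintro x ⟨w, hw, rfl⟩ y ⟨w', hw', rfl⟩ a b ha hb hab
    refine ⟨a • w + b • w', convex_rhombus hw hw' ha hb hab, ?_⟩
    have : (a : ℂ) + b = 1 := by exact_mod_cast hab
    simp only [Complex.real_smul]
    linear_combination (K.edge n i).1 * this
  refine convexHull_min ?_ hconv hx
  obtain ⟨s, hs, hap⟩ := K.apex_eq n i hi
  rintro z (rfl | rfl | rfl)
  · exact ⟨0, by simp [rhombus], by simp⟩
  · exact ⟨1, by simp [rhombus], by simp⟩
  · refine ⟨_, ?_, hap⟩
    constructor <;> norm_num [hs] <;> linarith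

theorem edge_fst_mem_cap (n i : ℕ) : (K.edge n i).1 ∈ K.cap n i :=
  subset_convexHull ℝ _ (by simp [vertices])

theorem edge_snd_mem_cap (n i : ℕ) : (K.edge n i).2 ∈ K.cap n i :=
  subset_convexHull ℝ _ (by simp [vertices])

theorem isClosed_cap (n i : ℕ) : IsClosed (K.cap n i) := by
  have : (K.vertices n i).Finite := by simp [vertices]
  exact (this.isCompact_convexHull (𝕜 := ℝ)).isClosed

theorem norm_le_of_mem_rhombus {w : ℂ} (hw : w ∈ rhombus) : ‖w‖ ≤ 1 := by
  obtain ⟨h1, h2⟩ := hw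
  have h0 := abs_nonneg w.im
  refine (Complex.norm_le_abs_re_add_abs_im w).trans ?_
  rw [abs_of_nonneg (by linarith)]
  linarith

theorem norm_sub_edge_fst_le (n i : ℕ) (hi : i < 2 ^ n) {x : ℂ} (hx : x ∈ K.cap n i) :
    ‖x - (K.edge n i).1‖ ≤ K.edgeLength n i := by
  obtain ⟨w, hw, rfl⟩ := K.cap_subset_rhombus n i hi hx
  rw [add_sub_cancel_left, norm_mul]
  exact mul_le_of_le_one_right (norm_nonneg _) (norm_le_of_mem_rhombus hw)

theorem norm_sub_edge_snd_le (n i : ℕ) (hi : i < 2 ^ n) {x : ℂ} (hx : x ∈ K.cap n i) :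
    ‖x - (K.edge n i).2‖ ≤ K.edgeLength n i := by
  obtain ⟨w, hw, rfl⟩ := K.cap_subset_rhombus n i hi hx
  have : (K.edge n i).1 + ((K.edge n i).2 - (K.edge n i).1) * w - (K.edge n i).2 =
      -(((K.edge n i).2 - (K.edge n i).1) * (1 - w)) := by ring
  rw [this, norm_neg, norm_mul]
  exact mul_le_of_le_one_right (norm_nonneg _) (norm_le_of_mem_rhombus (mem_rhombus_one_sub hw))

/-! ### Edge lengths -/

theorem cos_pos (n i : ℕ) (hi : i < 2 ^ n) : 0 < Real.cos (K.θ n i) := by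
  have h0 := K.θ_nonneg n i hi
  have h1 := K.θ_le n i hi
  have h2 := Real.arctan_lt_pi_div_two (2 * K.ε)
  exact Real.cos_pos_of_mem_Ioo ⟨by linarith [Real.pi_pos], by linarith⟩

theorem one_le_inv_cos (n i : ℕ) (hi : i < 2 ^ n) : 1 ≤ (Real.cos (K.θ n i))⁻¹ :=
  (one_le_inv₀ (K.cos_pos n i hi)).2 (Real.cos_le_one _)

theorem norm_half_add_mul_I {s φ : ℝ} (hφ : 0 < Real.cos φ) (hs : |s| = Real.tan φ / 2) :
    ‖(1 / 2 + (s : ℂ) * Complex.I)‖ = (Real.cos φ)⁻¹ / 2 := by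
  have h1 : ‖(1 / 2 + (s : ℂ) * Complex.I)‖ ^ 2 = 1 / 4 + s ^ 2 := by
    rw [← Complex.normSq_eq_norm_sq, Complex.normSq_apply]
    norm_num
    ring
  have h2 : ((Real.cos φ)⁻¹ / 2) ^ 2 = 1 / 4 + s ^ 2 := by
    rw [← sq_abs s, hs, Real.tan_eq_sin_div_cos]
    field_simp
    linarith [Real.sin_sq_add_cos_sq φ]
  exact (pow_left_inj₀ (norm_nonneg _) (by positivity) two_ne_zero).1 (h1.trans h2.symm)

/-- Both legs of an isosceles triangle with base angle `φ` have `(cos φ)⁻¹ / 2` times the length of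
the base. -/
theorem edgeLength_succ (n i : ℕ) (hi : i < 2 ^ (n + 1)) :
    K.edgeLength (n + 1) i = K.edgeLength n (i / 2) * ((Real.cos (K.θ n (i / 2)))⁻¹ / 2) := by
  have hj : i / 2 < 2 ^ n := by rw [pow_succ] at hi; omega
  obtain ⟨s, hs, hap⟩ := K.apex_eq n (i / 2) hj
  have hc := K.cos_pos n (i / 2) hj
  unfold edgeLength
  rcases Nat.mod_two_eq_zero_or_one i with h | h
  · rw [K.edge_succ_even n i h, hap]
    simp only [add_sub_cancel_left]
    rw [norm_mul, norm_half_add_mul_I hc hs]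
  · rw [K.edge_succ_odd n i h, hap, ← norm_half_add_mul_I (s := -s) hc (by rw [abs_neg, hs]),
      ← norm_mul]
    congr 1
    push_cast
    ring

theorem edgeLength_succ_le (n i : ℕ) (hi : i < 2 ^ (n + 1)) :
    K.edgeLength (n + 1) i ≤ K.edgeLength n (i / 2) * (51 / 100) := by
  have hj : i / 2 < 2 ^ n := by rw [pow_succ] at hi; omega
  obtain ⟨s, hs, -⟩ := K.apex_eq n (i / 2) hj
  rw [K.edgeLength_succ n i hi, ← norm_half_add_mul_I (K.cos_pos n (i / 2) hj) hs]
  refine mul_le_mul_of_nonneg_left ((norm_add_le _ _).trans ?_) (K.edgeLength_nonneg _ _)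
  have := (K.tan_bounds n (i / 2) hj).2
  rw [norm_mul, Complex.norm_I, Complex.norm_real, Real.norm_eq_abs, hs]
  norm_num
  linarith

theorem le_edgeLength (n i : ℕ) (hi : i < 2 ^ n) : ‖K.b - K.a‖ / 2 ^ n ≤ K.edgeLength n i := by
  induction n generalizing i with
  | zero => simp [edgeLength, edge]
  | succ n ih =>
    have hj : i / 2 < 2 ^ n := by rw [pow_succ] at hi; omega
    rw [K.edgeLength_succ n i hi, pow_succ, ← div_div, div_eq_mul_inv (_ / _) 2]
    exact mul_le_mul (ih _ hj) (by linarith [K.one_le_inv_cos n _ hj]) (by norm_num)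
      (K.edgeLength_nonneg _ _)

/-! ### Separation of caps -/

theorem edge_snd_eq_edge_fst_succ (n i : ℕ) (hi : i + 1 < 2 ^ n) :
    (K.edge n i).2 = (K.edge n (i + 1)).1 := by
  induction n generalizing i with
  | zero => simp at hi
  | succ n ih =>
    rcases Nat.mod_two_eq_zero_or_one i with h | h
    · rw [K.edge_succ_even n i h, K.edge_succ_odd n (i + 1) (by omega),
        show (i + 1) / 2 = i / 2 by omega]
    · rw [K.edge_succ_odd n i h, K.edge_succ_even n (i + 1) (by omega),
        show (i + 1) / 2 = i / 2 + 1 by omega]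
      exact ih _ (by rw [pow_succ] at hi; omega)

theorem edge_mul_two_pow_fst (n i k : ℕ) : (K.edge (n + k) (i * 2 ^ k)).1 = (K.edge n i).1 := by
  induction k with
  | zero => simp
  | succ k ih =>
    rw [← add_assoc, K.edge_succ_even _ _ (by rw [pow_succ, ← mul_assoc]; omega),
      show i * 2 ^ (k + 1) / 2 = i * 2 ^ k by rw [pow_succ, ← mul_assoc]; omega, ih]

/-- Multiplying a point of the rhombus by half the side direction of a flat triangle stays in a
sector around the positive real axis, and to the left of `1`. -/
theorem sector_bounds {s : ℝ} (hs : |s| ≤ 1 / 100) {w : ℂ} (hw : w ∈ rhombus) :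
    |((1 / 2 + (s : ℂ) * Complex.I) * w).im| ≤ ((1 / 2 + (s : ℂ) * Complex.I) * w).re / 10 ∧
    ((1 / 2 + (s : ℂ) * Complex.I) * w).re ≤ 3 / 5 := by
  obtain ⟨h1, h2⟩ := hw
  have h0 := abs_nonneg w.im
  have hsw : |s * w.im| ≤ 1 / 100 * (w.re / 50) := by
    rw [abs_mul]; exact mul_le_mul hs h1 h0 (by norm_num)
  have hsr : |s * w.re| ≤ 1 / 100 * w.re := by
    rw [abs_mul, abs_of_nonneg (a := w.re) (by linarith)]
    exact mul_le_mul_of_nonneg_right hs (by linarith)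
  have hre : ((1 / 2 + (s : ℂ) * Complex.I) * w).re = w.re / 2 - s * w.im := by
    simp; ring
  have him : ((1 / 2 + (s : ℂ) * Complex.I) * w).im = w.im / 2 + s * w.re := by
    simp; ring
  rw [hre, him]
  rw [abs_le] at *
  refine ⟨⟨?_, ?_⟩, ?_⟩ <;> linarith

theorem norm_add_norm_le_of_sector {p q : ℂ} (hp : |p.im| ≤ p.re / 10) (hq : |q.im| ≤ q.re / 10) :
    ‖p‖ + ‖q‖ ≤ 2 * ‖p + q‖ := by
  have h1 := Complex.norm_le_abs_re_add_abs_im p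
  have h2 := Complex.norm_le_abs_re_add_abs_im q
  have h3 := (le_abs_self _).trans (Complex.abs_re_le_norm (p + q))
  have h4 := abs_nonneg p.im
  have h5 := abs_nonneg q.im
  rw [abs_of_nonneg (by linarith)] at h1 h2
  rw [Complex.add_re] at h3
  linarith

theorem left_cap_coord (n i : ℕ) (hi : i < 2 ^ n) {x : ℂ} (hx : x ∈ K.cap (n + 1) (2 * i)) :
    ∃ s : ℝ, |s| ≤ 1 / 100 ∧
      K.apex n i = (K.edge n i).1 +
        ((K.edge n i).2 - (K.edge n i).1) * (1 / 2 + (s : ℂ) * Complex.I) ∧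
      ∃ w ∈ rhombus, x = (K.edge n i).1 +
        ((K.edge n i).2 - (K.edge n i).1) * ((1 / 2 + (s : ℂ) * Complex.I) * w) := by
  obtain ⟨s, hs, hap⟩ := K.apex_eq n i hi
  obtain ⟨w, hw, hxw⟩ := K.cap_subset_rhombus (n + 1) (2 * i) (by rw [pow_succ]; omega) hx
  refine ⟨s, by linarith [(K.tan_bounds n i hi).2], hap, w, hw, ?_⟩
  rw [hxw, K.edge_succ_even n _ (by omega), show 2 * i / 2 = i by omega, hap]
  ring

theorem right_cap_coord (n i : ℕ) (hi : i < 2 ^ n) {x : ℂ} (hx : x ∈ K.cap (n + 1) (2 * i + 1)) :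
    ∃ s : ℝ, |s| ≤ 1 / 100 ∧
      K.apex n i = (K.edge n i).2 -
        ((K.edge n i).2 - (K.edge n i).1) * (1 / 2 + (s : ℂ) * Complex.I) ∧
      ∃ w ∈ rhombus, x = (K.edge n i).2 -
        ((K.edge n i).2 - (K.edge n i).1) * ((1 / 2 + (s : ℂ) * Complex.I) * w) := by
  obtain ⟨s, hs, hap⟩ := K.apex_eq n i hi
  obtain ⟨w, hw, hxw⟩ := K.cap_subset_rhombus (n + 1) (2 * i + 1) (by rw [pow_succ]; omega) hx
  refine ⟨-s, by rw [abs_neg]; linarith [(K.tan_bounds n i hi).2], ?_, 1 - w,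
    mem_rhombus_one_sub hw, ?_⟩
  · rw [hap]; push_cast; ring
  · rw [hxw, K.edge_succ_odd n _ (by omega), show (2 * i + 1) / 2 = i by omega, hap]
    push_cast
    ring

theorem le_norm_edge_snd_sub (n i : ℕ) (hi : i < 2 ^ n) {x : ℂ} (hx : x ∈ K.cap (n + 1) (2 * i)) :
    2 / 5 * K.edgeLength n i ≤ ‖x - (K.edge n i).2‖ := by
  obtain ⟨s, hs, -, w, hw, rfl⟩ := K.left_cap_coord n i hi hx
  have h := (sector_bounds hs hw).2
  set z := (1 / 2 + (s : ℂ) * Complex.I) * w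
  have : (K.edge n i).1 + ((K.edge n i).2 - (K.edge n i).1) * z - (K.edge n i).2 =
      -(((K.edge n i).2 - (K.edge n i).1) * (1 - z)) := by ring
  rw [this, norm_neg, norm_mul, mul_comm]
  refine mul_le_mul_of_nonneg_left ?_ (norm_nonneg _)
  refine le_trans ?_ ((le_abs_self _).trans (Complex.abs_re_le_norm (1 - z)))
  rw [Complex.sub_re, Complex.one_re]
  linarith

theorem le_norm_edge_fst_sub (n i : ℕ) (hi : i < 2 ^ n) {x : ℂ}
    (hx : x ∈ K.cap (n + 1) (2 * i + 1)) :
    2 / 5 * K.edgeLength n i ≤ ‖x - (K.edge n i).1‖ := by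
  obtain ⟨s, hs, -, w, hw, rfl⟩ := K.right_cap_coord n i hi hx
  have h := (sector_bounds hs hw).2
  set z := (1 / 2 + (s : ℂ) * Complex.I) * w
  have : (K.edge n i).2 - ((K.edge n i).2 - (K.edge n i).1) * z - (K.edge n i).1 =
      ((K.edge n i).2 - (K.edge n i).1) * (1 - z) := by ring
  rw [this, norm_mul, mul_comm]
  refine mul_le_mul_of_nonneg_left ?_ (norm_nonneg _)
  refine le_trans ?_ ((le_abs_self _).trans (Complex.abs_re_le_norm (1 - z)))
  rw [Complex.sub_re, Complex.one_re]
  linarith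

/-- Seen from the apex of a cap, the two caps inside it lie in nearly opposite sectors. -/
theorem norm_add_norm_le_of_siblings (n i : ℕ) (hi : i < 2 ^ n) {x y : ℂ}
    (hx : x ∈ K.cap (n + 1) (2 * i)) (hy : y ∈ K.cap (n + 1) (2 * i + 1)) :
    ‖x - K.apex n i‖ + ‖y - K.apex n i‖ ≤ 2 * ‖y - x‖ := by
  obtain ⟨s, hs, hap, w, hw, hxw⟩ := K.left_cap_coord n i hi hx
  obtain ⟨s', hs', hap', w', hw', hyw⟩ := K.right_cap_coord n i hi hy
  have h := (sector_bounds hs (mem_rhombus_one_sub hw)).1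
  have h' := (sector_bounds hs' (mem_rhombus_one_sub hw')).1
  have e1 : x - K.apex n i = -(((K.edge n i).2 - (K.edge n i).1) *
      ((1 / 2 + (s : ℂ) * Complex.I) * (1 - w))) := by rw [hxw, hap]; ring
  have e2 : y - K.apex n i = ((K.edge n i).2 - (K.edge n i).1) *
      ((1 / 2 + (s' : ℂ) * Complex.I) * (1 - w')) := by rw [hyw, hap']; ring
  have e3 : y - x = ((K.edge n i).2 - (K.edge n i).1) *
      ((1 / 2 + (s : ℂ) * Complex.I) * (1 - w) +
        (1 / 2 + (s' : ℂ) * Complex.I) * (1 - w')) := by linear_combination e2 - e1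
  rw [e1, e2, e3, norm_neg, norm_mul, norm_mul (_ - _) (_ * (1 - w')),
    norm_mul (_ - _) (_ + _), ← mul_add, mul_left_comm]
  exact mul_le_mul_of_nonneg_left (norm_add_norm_le_of_sector h h') (norm_nonneg _)

/-- Neighbouring caps lie in nearly opposite sectors, seen from their common vertex: they are
contained in the two halves of the cap in which their common vertex first appeared as an apex. -/
theorem norm_add_norm_le_of_adjacent (n i : ℕ) (hi : i + 1 < 2 ^ n) {x y : ℂ}
    (hx : x ∈ K.cap n i) (hy : y ∈ K.cap n (i + 1)) :
    ‖x - (K.edge n (i + 1)).1‖ + ‖y - (K.edge n (i + 1)).1‖ ≤ 2 * ‖y - x‖ := by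
  induction n generalizing i with
  | zero => simp at hi
  | succ n ih =>
    rw [pow_succ] at hi
    obtain ⟨j, rfl | rfl⟩ : ∃ j, i = 2 * j ∨ i = 2 * j + 1 := ⟨i / 2, by omega⟩
    · rw [K.edge_succ_odd n _ (by omega), show (2 * j + 1) / 2 = j by omega]
      exact K.norm_add_norm_le_of_siblings n j (by omega) hx hy
    · rw [K.edge_succ_even n _ (by omega), show (2 * j + 1 + 1) / 2 = j + 1 by omega]
      have hx' := K.cap_subset n _ (by rw [pow_succ]; omega) hx
      have hy' := K.cap_subset n _ (by rw [pow_succ]; omega) hy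
      rw [show (2 * j + 1) / 2 = j by omega] at hx'
      rw [show (2 * j + 1 + 1) / 2 = j + 1 by omega] at hy'
      exact ih j (by omega) hx' hy'

/-- Caps of level `n` that are not neighbours have a distance comparable to `2 ^ (-n)`. -/
theorem le_norm_sub_of_not_adjacent (n i j : ℕ) (hij : i + 2 ≤ j) (hj : j < 2 ^ n) {x y : ℂ}
    (hx : x ∈ K.cap n i) (hy : y ∈ K.cap n j) :
    ‖K.b - K.a‖ / 5 / 2 ^ n ≤ ‖y - x‖ := by
  induction n generalizing i j with
  | zero => simp at hj; omega
  | succ n ih =>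
    have hpow : ‖K.b - K.a‖ / 5 / 2 ^ (n + 1) ≤ ‖K.b - K.a‖ / 5 / 2 ^ n := by
      gcongr <;> norm_num
    have hx' := K.cap_subset n _ (by omega) hx
    have hy' := K.cap_subset n _ hj hy
    rw [pow_succ] at hj
    rcases Nat.lt_or_ge (i / 2 + 1) (j / 2) with h | h
    · exact hpow.trans (ih (i / 2) (j / 2) (by omega) (by omega) hx' hy')
    · have hji : j / 2 = i / 2 + 1 := by omega
      refine hpow.trans ?_
      rw [hji] at hy'
      have key := K.norm_add_norm_le_of_adjacent n (i / 2) (by omega) hx' hy'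
      rw [div_right_comm]
      rcases Nat.mod_two_eq_zero_or_one i with h2 | h2
      · have h3 := K.le_norm_edge_snd_sub n (i / 2) (by omega)
          (x := x) (by rwa [show 2 * (i / 2) = i by omega])
        rw [K.edge_snd_eq_edge_fst_succ n _ (by omega)] at h3
        linarith [K.le_edgeLength n (i / 2) (by omega),
          norm_nonneg (y - (K.edge n (i / 2 + 1)).1)]
      · have h3 := K.le_norm_edge_fst_sub n (j / 2) (by omega)
          (x := y) (by rwa [show 2 * (j / 2) + 1 = j by omega])
        rw [hji] at h3
        linarith [K.le_edgeLength n (i / 2 + 1) (by omega),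
          norm_nonneg (x - (K.edge n (i / 2 + 1)).1)]

/-! ### The parametrization of the limit set -/

theorem norm_b_sub_a_pos : 0 < ‖K.b - K.a‖ :=
  norm_pos_iff.2 (sub_ne_zero.2 K.a_ne_b.symm)

theorem approxMap_mem_cap (n : ℕ) {t : ℝ} (ht : t ∈ Icc (0 : ℝ) 1) :
    K.approxMap n t ∈ K.cap n (dyadicIndex n t) := by
  have h1 := dyadicIndex_le n ht.1
  have h2 := le_dyadicIndex n ht.2
  exact (convex_convexHull ℝ (K.vertices n _)).lineMap_mem (K.edge_fst_mem_cap n _)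
    (K.edge_snd_mem_cap n _) ⟨by linarith, by linarith⟩

theorem cap_dyadicIndex_antitone (t : ℝ) : Antitone fun n => K.cap n (dyadicIndex n t) :=
  antitone_nat_of_succ_le fun n => by
    have := K.cap_subset n _ (dyadicIndex_lt (n + 1) t)
    rwa [dyadicIndex_succ_div] at this

theorem kochMap_mem_cap (n : ℕ) {t : ℝ} (ht : t ∈ Icc (0 : ℝ) 1) :
    K.kochMap t ∈ K.cap n (dyadicIndex n t) := by
  refine (K.isClosed_cap n _).mem_of_tendsto (K.tendsto_approxMap ht.1 ht.2) ?_
  filter_upwards [eventually_ge_atTop n] with N hN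
  exact K.cap_dyadicIndex_antitone t hN (K.approxMap_mem_cap N ht)

theorem kochMap_mem_limitSet {t : ℝ} (ht : t ∈ Icc (0 : ℝ) 1) : K.kochMap t ∈ K.limitSet :=
  mem_iInter.2 fun n => mem_iUnion₂.2
    ⟨_, Finset.mem_range.2 (dyadicIndex_lt n t), K.kochMap_mem_cap n ht⟩

theorem exists_three_le_two_pow_mul {δ : ℝ} (h0 : 0 < δ) (h1 : δ ≤ 1) :
    ∃ n : ℕ, 3 ≤ 2 ^ n * δ ∧ 2 ^ n * δ ≤ 6 := by
  classical
  have hex : ∃ n : ℕ, 3 ≤ 2 ^ n * δ := by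
    obtain ⟨n, hn⟩ := pow_unbounded_of_one_lt (3 / δ) (one_lt_two (α := ℝ))
    exact ⟨n, ((div_lt_iff₀ h0).1 hn).le⟩
  refine ⟨Nat.find hex, Nat.find_spec hex, ?_⟩
  rcases h : Nat.find hex with _ | n
  · norm_num; linarith
  · have := Nat.find_min hex (m := n) (by omega)
    rw [pow_succ]
    linarith

/-- The inverse of the parametrization is Lipschitz: points whose distance in `[0, 1]` is about
`2 ^ (-n)` are mapped into caps of level `n` that are not neighbours. -/
theorem mul_sub_le_norm_kochMap_sub {s t : ℝ} (hs : s ∈ Icc (0 : ℝ) 1) (ht : t ∈ Icc (0 : ℝ) 1)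
    (hst : s < t) : ‖K.b - K.a‖ / 30 * (t - s) ≤ ‖K.kochMap t - K.kochMap s‖ := by
  obtain ⟨n, hn3, hn6⟩ := exists_three_le_two_pow_mul (sub_pos.2 hst) (by linarith [hs.1, ht.2])
  have h1 := dyadicIndex_le n hs.1
  have h2 := le_dyadicIndex n ht.2
  have hij : dyadicIndex n s + 2 ≤ dyadicIndex n t := by
    have : (dyadicIndex n s + 2 : ℝ) ≤ dyadicIndex n t := by linarith
    exact_mod_cast this
  refine le_trans ?_ (K.le_norm_sub_of_not_adjacent n _ _ hij (dyadicIndex_lt n t)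
    (K.kochMap_mem_cap n hs) (K.kochMap_mem_cap n ht))
  rw [le_div_iff₀ (by positivity)]
  nlinarith [norm_nonneg (K.b - K.a)]

theorem dist_le_kochMap {s t : ℝ} (hs : s ∈ Icc (0 : ℝ) 1) (ht : t ∈ Icc (0 : ℝ) 1) :
    dist s t ≤ 30 / ‖K.b - K.a‖ * dist (K.kochMap s) (K.kochMap t) := by
  have hL := K.norm_b_sub_a_pos
  wlog hst : s < t generalizing s t
  · rcases (not_lt.1 hst).eq_or_lt with rfl | h
    · simp
    · rw [dist_comm, dist_comm (K.kochMap s)]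
      exact this ht hs h
  have := K.mul_sub_le_norm_kochMap_sub hs ht hst
  rw [dist_comm, dist_comm (K.kochMap s), Real.dist_eq, abs_of_pos (sub_pos.2 hst), dist_eq_norm]
  rw [div_mul_eq_mul_div, le_div_iff₀ hL]
  linarith

theorem injOn_kochMap : InjOn K.kochMap (Icc 0 1) := fun s hs t ht h => by
  have := K.dist_le_kochMap hs ht
  rw [h, dist_self, mul_zero] at this
  exact dist_le_zero.1 this

/-- A common point of two caps of the same level is the common vertex of neighbouring caps. -/
theorem eq_of_mem_cap_of_mem_cap {n i j : ℕ} (hij : i < j) (hj : j < 2 ^ n) {x : ℂ}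
    (hxi : x ∈ K.cap n i) (hxj : x ∈ K.cap n j) : j = i + 1 ∧ x = (K.edge n j).1 := by
  have hL := K.norm_b_sub_a_pos
  have hji : j = i + 1 := by
    by_contra hne
    have := K.le_norm_sub_of_not_adjacent n i j (by omega) hj hxi hxj
    rw [sub_self, norm_zero] at this
    have : 0 < ‖K.b - K.a‖ / 5 / 2 ^ n := by positivity
    linarith
  subst hji
  have := K.norm_add_norm_le_of_adjacent n i hj hxi hxj
  rw [sub_self, norm_zero, mul_zero] at this
  exact ⟨rfl, sub_eq_zero.1 (norm_le_zero_iff.1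
    (by linarith [norm_nonneg (x - (K.edge n (i + 1)).1)]))⟩

theorem dyadicIndex_eq_of_lt {n i : ℕ} (hi : i < 2 ^ n) {t : ℝ} (h0 : (i : ℝ) ≤ 2 ^ n * t)
    (h1 : 2 ^ n * t < i + 1) : dyadicIndex n t = i := by
  have : ⌊(2 : ℝ) ^ n * t⌋₊ = i :=
    (Nat.floor_eq_iff (le_trans (Nat.cast_nonneg _) h0)).2 ⟨h0, h1⟩
  unfold dyadicIndex
  omega

theorem lt_dyadicIndex_add_one {n : ℕ} {t : ℝ} (h : dyadicIndex n t + 1 < 2 ^ n) :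
    2 ^ n * t < dyadicIndex n t + 1 := by
  have h1 := Nat.lt_floor_add_one ((2 : ℝ) ^ n * t)
  have : dyadicIndex n t = ⌊(2 : ℝ) ^ n * t⌋₊ := by unfold dyadicIndex at *; omega
  rwa [this]

theorem kochMap_ne_edge_fst {n i : ℕ} {t : ℝ} (ht : t ∈ Icc (0 : ℝ) 1) (hi : i < 2 ^ n)
    (h : 2 ^ n * t < i) : K.kochMap t ≠ (K.edge n i).1 := by
  intro heq
  obtain ⟨k, hk⟩ := pow_unbounded_of_one_lt (2 / (i - 2 ^ n * t)) (one_lt_two (α := ℝ))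
  rw [div_lt_iff₀ (by linarith)] at hk
  have h1 := dyadicIndex_le (n + k) ht.1
  have hlt : dyadicIndex (n + k) t + 2 ≤ i * 2 ^ k := by
    have : (dyadicIndex (n + k) t + 2 : ℝ) ≤ i * 2 ^ k := by
      rw [pow_add] at h1
      nlinarith
    exact_mod_cast this
  have hlt' : i * 2 ^ k < 2 ^ (n + k) := by
    rw [pow_add]
    exact Nat.mul_lt_mul_of_pos_right hi (by positivity)
  have hmem := K.edge_fst_mem_cap (n + k) (i * 2 ^ k)
  rw [K.edge_mul_two_pow_fst, ← heq] at hmem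
  have := (K.eq_of_mem_cap_of_mem_cap (by omega) hlt' (K.kochMap_mem_cap (n + k) ht) hmem).1
  omega

theorem capIndex_kochMap (n : ℕ) {t : ℝ} (ht : t ∈ Icc (0 : ℝ) 1) :
    K.capIndex n (K.kochMap t) = dyadicIndex n t := by
  classical
  have hlt := dyadicIndex_lt n t
  unfold capIndex
  rw [Nat.findGreatest_eq_iff]
  refine ⟨by omega, fun _ => K.kochMap_mem_cap n ht, fun i hi hin hmem => ?_⟩
  obtain ⟨rfl, hx⟩ := K.eq_of_mem_cap_of_mem_cap hi (by omega) (K.kochMap_mem_cap n ht) hmem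
  refine K.kochMap_ne_edge_fst ht (by omega) ?_ hx
  exact_mod_cast lt_dyadicIndex_add_one (n := n) (t := t) (by omega)

theorem capIndex_lt (n : ℕ) (x : ℂ) : K.capIndex n x < 2 ^ n := by
  classical
  have : K.capIndex n x ≤ 2 ^ n - 1 := Nat.findGreatest_le _
  have : 0 < 2 ^ n := by positivity
  omega

theorem mem_cap_capIndex (n : ℕ) {x : ℂ} (hx : x ∈ K.limitSet) : x ∈ K.cap n (K.capIndex n x) := by
  classical
  obtain ⟨i, hi, hxi⟩ := mem_iUnion₂.1 (mem_iInter.1 hx n)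
  rw [Finset.mem_range] at hi
  exact Nat.findGreatest_spec (P := fun i => x ∈ K.cap n i) (show i ≤ 2 ^ n - 1 by omega) hxi

theorem le_capIndex {n i : ℕ} (hi : i < 2 ^ n) {x : ℂ} (hx : x ∈ K.cap n i) :
    i ≤ K.capIndex n x := by
  classical
  exact Nat.le_findGreatest (by omega) hx

/-- The caps selected by `capIndex` are nested. -/
theorem capIndex_succ_div (n : ℕ) {x : ℂ} (hx : x ∈ K.limitSet) :
    K.capIndex (n + 1) x / 2 = K.capIndex n x := by
  have h1 := K.capIndex_lt (n + 1) x
  have h2 := K.capIndex_lt n x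
  have hmem := K.cap_subset n _ h1 (K.mem_cap_capIndex (n + 1) hx)
  have hle := K.le_capIndex (by rw [pow_succ] at h1; omega) hmem
  refine hle.eq_or_lt.resolve_right fun hlt => ?_
  -- Otherwise `x` is the left vertex of `T n (capIndex n x)`, hence of the left cap inside it.
  have hx1 := (K.eq_of_mem_cap_of_mem_cap hlt h2 hmem (K.mem_cap_capIndex n hx)).2
  have hmem' := K.edge_fst_mem_cap (n + 1) (K.capIndex n x * 2 ^ 1)
  rw [K.edge_mul_two_pow_fst, ← hx1] at hmem'
  have := K.le_capIndex (by rw [pow_succ]; omega) hmem'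
  omega

theorem norm_sub_le_of_mem_cap {n i j : ℕ} (hij : i ≤ j) (hji : j ≤ i + 1) (hj : j < 2 ^ n)
    {x y : ℂ} (hx : x ∈ K.cap n i) (hy : y ∈ K.cap n j) :
    ‖y - x‖ ≤ K.edgeLength n i + K.edgeLength n j := by
  rcases hij.eq_or_lt with rfl | h
  · have e1 := K.norm_sub_edge_fst_le n i hj hx
    have e2 := K.norm_sub_edge_fst_le n i hj hy
    have := norm_sub_le_norm_sub_add_norm_sub y (K.edge n i).1 x
    rw [norm_sub_rev (K.edge n i).1 x] at this
    linarith
  · obtain rfl : j = i + 1 := by omega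
    have e1 := K.norm_sub_edge_snd_le n i (by omega) hx
    have e2 := K.norm_sub_edge_fst_le n (i + 1) hj hy
    rw [K.edge_snd_eq_edge_fst_succ n i hj] at e1
    have := norm_sub_le_norm_sub_add_norm_sub y (K.edge n (i + 1)).1 x
    rw [norm_sub_rev (K.edge n (i + 1)).1 x] at this
    linarith

theorem exists_kochMap_eq {x : ℂ} (hx : x ∈ K.limitSet) : ∃ t ∈ Icc (0 : ℝ) 1, K.kochMap t = x := by
  set I : ℕ → Set ℝ := fun n =>
    Icc ((K.capIndex n x : ℝ) / 2 ^ n) ((K.capIndex n x + 1 : ℝ) / 2 ^ n) with hI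
  have hanti : ∀ n, I (n + 1) ⊆ I n := by
    intro n
    have h := K.capIndex_succ_div n hx
    have h1 : (2 * K.capIndex n x : ℝ) ≤ K.capIndex (n + 1) x := by exact_mod_cast (by omega)
    have h2 : (K.capIndex (n + 1) x : ℝ) ≤ 2 * K.capIndex n x + 1 := by exact_mod_cast (by omega)
    refine Icc_subset_Icc ?_ ?_ <;> rw [div_le_div_iff₀ (by positivity) (by positivity), pow_succ]
    · nlinarith [show (0 : ℝ) < 2 ^ n by positivity]
    · nlinarith [show (0 : ℝ) < 2 ^ n by positivity]
  obtain ⟨t, ht⟩ := IsCompact.nonempty_iInter_of_sequence_nonempty_isCompact_isClosed I hanti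
    (fun n => nonempty_Icc.2 (by gcongr; linarith)) isCompact_Icc (fun n => isClosed_Icc)
  rw [mem_iInter] at ht
  have ht01 : t ∈ Icc (0 : ℝ) 1 := by
    have h0 : K.capIndex 0 x = 0 := by simpa using K.capIndex_lt 0 x
    simpa [hI, h0] using ht 0
  refine ⟨t, ht01, ?_⟩
  have hbound : ∀ n, ‖K.kochMap t - x‖ ≤ 2 * (‖K.b - K.a‖ * (51 / 100) ^ n) := by
    intro n
    have hp : (0 : ℝ) < 2 ^ n := by positivity
    obtain ⟨hl, hr⟩ := ht n
    rw [div_le_iff₀ hp] at hl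
    rw [le_div_iff₀ hp] at hr
    have hlt := K.capIndex_lt n x
    have hlt' := dyadicIndex_lt n t
    have hlo : K.capIndex n x ≤ dyadicIndex n t := by
      have : K.capIndex n x ≤ ⌊(2 : ℝ) ^ n * t⌋₊ := Nat.le_floor (by linarith)
      unfold dyadicIndex
      omega
    have hup : dyadicIndex n t ≤ K.capIndex n x + 1 := by
      have := dyadicIndex_le n ht01.1
      have : (dyadicIndex n t : ℝ) ≤ K.capIndex n x + 1 := by linarith
      exact_mod_cast this
    have := K.norm_sub_le_of_mem_cap hlo hup hlt' (K.mem_cap_capIndex n hx)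
      (K.kochMap_mem_cap n ht01)
    have e1 : K.edgeLength n _ ≤ _ := K.norm_edge_le n _ hlt
    have e2 : K.edgeLength n _ ≤ _ := K.norm_edge_le n _ hlt'
    linarith
  have hlim : Tendsto (fun n : ℕ => 2 * (‖K.b - K.a‖ * (51 / 100 : ℝ) ^ n)) atTop (𝓝 0) := by
    simpa using ((tendsto_pow_atTop_nhds_zero_of_lt_one (r := (51 / 100 : ℝ)) (by norm_num)
      (by norm_num)).const_mul ‖K.b - K.a‖).const_mul 2
  exact sub_eq_zero.1 (norm_le_zero_iff.1 (ge_of_tendsto' hlim hbound))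

/-! ### Stretch products and Lipschitz bounds -/

theorem edgeLength_dyadicIndex (n : ℕ) {t : ℝ} (ht : t ∈ Icc (0 : ℝ) 1) :
    K.edgeLength n (dyadicIndex n t) = ‖K.b - K.a‖ / 2 ^ n * K.stretch n (K.kochMap t) := by
  induction n with
  | zero => simp [edgeLength, edge, stretch]
  | succ n ih =>
    rw [K.edgeLength_succ n _ (dyadicIndex_lt _ t), dyadicIndex_succ_div, ih]
    simp only [stretch, Finset.prod_range_succ, K.capIndex_kochMap n ht, pow_succ]
    field_simp

theorem stretch_mono (x : ℂ) : Monotone fun N => K.stretch N x := by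
  refine monotone_nat_of_le_succ fun N => ?_
  simp only [stretch, Finset.prod_range_succ]
  exact le_mul_of_one_le_right (Finset.prod_nonneg fun n _ =>
    zero_le_one.trans (K.one_le_inv_cos n _ (K.capIndex_lt n x)))
    (K.one_le_inv_cos N _ (K.capIndex_lt N x))

theorem exists_stretch_le {x : ℂ} (h : ¬ Tendsto (fun N => K.stretch N x) atTop atTop) :
    ∃ M : ℕ, ∀ N, K.stretch N x ≤ M := by
  by_contra! hM
  refine h (tendsto_atTop_atTop_of_monotone (K.stretch_mono x) fun b => ?_)
  obtain ⟨M, hbM⟩ := exists_nat_ge b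
  obtain ⟨N, hN⟩ := hM M
  exact ⟨N, hbM.trans hN.le⟩

/-- On the set of parameters with stretch product at most `M` the parametrization is Lipschitz:
parameters at distance about `2 ^ (-n)` are mapped into neighbouring caps of level `n`, whose
bases have length at most `M * ‖b - a‖ / 2 ^ n`. -/
theorem lipschitzOnWith_kochMap (M : ℕ) : ∃ C : NNReal, LipschitzOnWith C K.kochMap
    {t ∈ Icc (0 : ℝ) 1 | ∀ N, K.stretch N (K.kochMap t) ≤ M} := by
  refine ⟨Real.toNNReal (16 * ‖K.b - K.a‖ * M), LipschitzOnWith.of_dist_le_mul ?_⟩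
  rw [Real.coe_toNNReal _ (by positivity)]
  intro s hs t ht
  wlog hst : s < t generalizing s t
  · rcases (not_lt.1 hst).eq_or_lt with rfl | h
    · simp
    · rw [dist_comm, dist_comm s]
      exact this t ht s hs h
  obtain ⟨hs, hsM⟩ := hs
  obtain ⟨ht, htM⟩ := ht
  have hδ : 0 < t - s := sub_pos.2 hst
  obtain ⟨n, hn3, hn6⟩ := exists_three_le_two_pow_mul hδ (by linarith [hs.1, ht.2])
  have hlen : ∀ u ∈ Icc (0 : ℝ) 1, (∀ N, K.stretch N (K.kochMap u) ≤ M) → ∀ m,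
      K.edgeLength m (dyadicIndex m u) ≤ ‖K.b - K.a‖ / 2 ^ m * M := fun u hu huM m => by
    rw [K.edgeLength_dyadicIndex m hu]
    exact mul_le_mul_of_nonneg_left (huM m) (by positivity)
  rw [dist_comm, dist_comm s, dist_eq_norm, Real.dist_eq, abs_of_pos hδ]
  -- Three levels above `n` the parameters differ by less than `2 ^ (-m)`, so their indices differ
  -- by at most one.
  obtain ⟨m, hm, hidx, hidx'⟩ : ∃ m, (1 : ℝ) ≤ 2 ^ m * 8 * (t - s) ∧
      dyadicIndex m s ≤ dyadicIndex m t ∧ dyadicIndex m t ≤ dyadicIndex m s + 1 := by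
    have hmono : ∀ m, dyadicIndex m s ≤ dyadicIndex m t := fun m =>
      min_le_min_right _ (Nat.floor_le_floor (by gcongr))
    refine ⟨n - 3, ?_, hmono _, ?_⟩
    · have : (2 : ℝ) ^ n ≤ 2 ^ (n - 3) * 8 := by
        rw [show (8 : ℝ) = 2 ^ 3 by norm_num, ← pow_add]
        exact pow_le_pow_right₀ one_le_two (by omega)
      nlinarith
    · rcases Nat.lt_or_ge n 3 with h | h
      · have := dyadicIndex_lt (n - 3) t
        rw [show n - 3 = 0 by omega] at *
        simp only [pow_zero] at this
        omega
      · have hpow : (2 : ℝ) ^ n = 2 ^ (n - 3) * 8 := by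
          rw [show (8 : ℝ) = 2 ^ 3 by norm_num, ← pow_add]
          congr 1
          omega
        by_contra! hlt
        have h1 := dyadicIndex_le (n - 3) ht.1
        have h2 := lt_dyadicIndex_add_one (n := n - 3) (t := s)
          (by have := dyadicIndex_lt (n - 3) t; omega)
        have h3 : (dyadicIndex (n - 3) s + 2 : ℝ) ≤ dyadicIndex (n - 3) t := by exact_mod_cast hlt
        rw [hpow] at hn6
        linarith
  refine (K.norm_sub_le_of_mem_cap hidx hidx' (dyadicIndex_lt m t)
    (K.kochMap_mem_cap m hs) (K.kochMap_mem_cap m ht)).trans ?_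
  refine (add_le_add (hlen s hs hsM m) (hlen t ht htM m)).trans ?_
  have hp : (0 : ℝ) < 2 ^ m := by positivity
  have : ‖K.b - K.a‖ / 2 ^ m ≤ 8 * ‖K.b - K.a‖ * (t - s) := by
    rw [div_le_iff₀ hp]
    nlinarith [norm_nonneg (K.b - K.a)]
  nlinarith [(Nat.cast_nonneg M : (0 : ℝ) ≤ M)]

end KochConstruction

/-! ### Lipschitz functions of a real variable -/

/-- Up to a set with null image, the line is a countable union of sets on which a given Lipschitz
function `g` has a Lipschitz inverse.  The image of the set where `g` is not differentiable is null
by Rademacher's theorem, the image of the set where the derivative vanishes by Sard's. -/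
theorem LipschitzWith.exists_antilipschitzWith_restrict {C : NNReal} {g : ℝ → ℝ}
    (hg : LipschitzWith C g) : ∃ S : ℕ × ℤ → Set ℝ, volume (g '' (⋃ p, S p)ᶜ) = 0 ∧
      ∀ p, ∃ k : NNReal, AntilipschitzWith k ((S p).domRestrict g) := by
  refine ⟨fun p => {s | ⌊s * (p.1 + 1)⌋ = p.2 ∧
    ∀ s', |s' - s| < 1 / (p.1 + 1) → |s' - s| ≤ (p.1 + 1) * |g s' - g s|}, ?_, ?_⟩
  · have hN : volume (g '' {s | ¬ DifferentiableAt ℝ g s}) = 0 := by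
      have h := hg.hausdorffMeasure_image_le zero_le_one {s | ¬ DifferentiableAt ℝ g s}
      rw [hausdorffMeasure_real, ae_iff.1 hg.ae_differentiableAt_real, mul_zero] at h
      exact le_antisymm h zero_le
    have hZ : volume (g '' {s | HasDerivAt g 0 s}) = 0 :=
      addHaar_image_eq_zero_of_det_fderivWithin_eq_zero volume (f' := fun _ => 0)
        (fun s hs => by simpa using (HasDerivAt.hasFDerivAt hs).hasFDerivWithinAt)
        (fun s _ => by simp [ContinuousLinearMap.det])
    refine measure_mono_null ?_ (measure_union_null hN hZ)
    rw [← image_union]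
    refine image_mono fun s hs => ?_
    by_contra hcon
    rw [mem_union, not_or] at hcon
    obtain ⟨hd, hz⟩ := hcon
    simp only [mem_ofPred_eq, not_not] at hd hz
    have hder := hd.hasDerivAt
    have hne : deriv g s ≠ 0 := fun h => hz (h ▸ hder)
    have hpos : 0 < |deriv g s| := abs_pos.2 hne
    obtain ⟨r, hr, hball⟩ := Metric.eventually_nhds_iff.1
      ((hasDerivAt_iff_isLittleO.1 hder).def (half_pos hpos))
    obtain ⟨k, hk⟩ := exists_nat_ge (max (2 / |deriv g s|) (1 / r))
    have hk1 : 2 ≤ (k + 1) * |deriv g s| := by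
      rw [← div_le_iff₀ hpos]
      linarith [le_max_left (2 / |deriv g s|) (1 / r)]
    have hk2 : 1 / ((k : ℝ) + 1) ≤ r := by
      rw [div_le_iff₀ (by positivity), mul_comm, ← div_le_iff₀ hr]
      linarith [le_max_right (2 / |deriv g s|) (1 / r)]
    refine hs (mem_iUnion.2 ⟨(k, ⌊s * (k + 1)⌋), rfl, fun s' hs' => ?_⟩)
    have h := hball (y := s') (by rw [Real.dist_eq]; exact hs'.trans_le hk2)
    rw [Real.norm_eq_abs, Real.norm_eq_abs, smul_eq_mul] at h
    have h2 := abs_sub_abs_le_abs_sub ((s' - s) * deriv g s) (g s' - g s)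
    rw [abs_mul, abs_sub_comm (_ * _)] at h2
    have h3 : |deriv g s| / 2 * |s' - s| ≤ |g s' - g s| := by linarith
    have h4 := mul_le_mul_of_nonneg_left h3 (show (0 : ℝ) ≤ k + 1 by positivity)
    nlinarith [abs_nonneg (s' - s)]
  · rintro ⟨k, l⟩
    refine ⟨k + 1, AntilipschitzWith.of_le_mul_dist ?_⟩
    rintro ⟨x, hx, hx'⟩ ⟨y, hy, hy'⟩
    rw [Subtype.dist_eq, Real.dist_eq, Real.dist_eq]
    refine hy' x ?_
    have h := Int.abs_sub_lt_one_of_floor_eq_floor (hx.trans hy.symm)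
    rw [← sub_mul, abs_mul, abs_of_nonneg (a := (k + 1 : ℝ)) (by positivity)] at h
    rwa [lt_div_iff₀ (by positivity)]

namespace KochConstruction

variable (K : KochConstruction)

/-! ### Pieces on which the parametrization is Lipschitz -/

/-- If the parametrization is Lipschitz on `D`, the stretch product is finite at almost every point
`t` of `D`: for a density point `t` of `D`, the cap of level `n` over `t` contains images of points
of `D` close to both ends of its base, so that the length of the base is `O(2 ^ (-n))`. -/
theorem volume_stretch_atTop_eq_zero {D : Set ℝ} (hD : D ⊆ Icc 0 1) {C : NNReal}
    (hC : LipschitzOnWith C K.kochMap D) :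
    volume {t ∈ D | Tendsto (fun N => K.stretch N (K.kochMap t)) atTop atTop} = 0 := by
  have hae := IsUnifLocDoublingMeasure.ae_tendsto_measure_inter_div (volume : Measure ℝ) D 16
  have h0 := (Measure.le_restrict_apply (μ := volume) D _).trans_eq (ae_iff.1 hae)
  refine measure_mono_null ?_ (le_antisymm h0 zero_le)
  rintro t ⟨htD, htop⟩
  refine ⟨fun hdens => ?_, htD⟩
  have ht := hD htD
  have hL := K.norm_b_sub_a_pos
  have hnear : ∀ c ∈ Icc (0 : ℝ) 1, ∀ᶠ n : ℕ in atTop,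
      ∃ u ∈ D, |2 ^ n * u - (dyadicIndex n t + c)| ≤ 1 / 16 := by
    intro c hc
    have hδ : Tendsto (fun n : ℕ => (1 / 16 : ℝ) / 2 ^ n) atTop (𝓝[>] 0) := by
      refine tendsto_nhdsWithin_iff.2 ⟨?_, Eventually.of_forall fun n => by
        rw [mem_Ioi]; positivity⟩
      simpa using ((tendsto_pow_atTop_nhds_zero_of_lt_one (r := (1 / 2 : ℝ)) (by norm_num)
        (by norm_num)).const_mul (1 / 16)).congr fun n => by
          rw [one_div_pow, mul_one_div, one_div]
    have hlim := hdens (fun n => (dyadicIndex n t + c) / 2 ^ n) _ hδ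
      (Eventually.of_forall fun n => by
        have hp : (0 : ℝ) < 2 ^ n := by positivity
        have h1 := dyadicIndex_le n ht.1
        have h2 := le_dyadicIndex n ht.2
        rw [Metric.mem_closedBall, Real.dist_eq, show t - (dyadicIndex n t + c) / 2 ^ n =
          (2 ^ n * t - (dyadicIndex n t + c)) / 2 ^ n by field_simp, abs_div, abs_of_pos hp,
          ← mul_div_assoc, div_le_div_iff_of_pos_right hp, abs_le]
        constructor <;> linarith [hc.1, hc.2])
    filter_upwards [hlim.eventually_ne one_ne_zero] with n hn
    have hne : volume (D ∩ Metric.closedBall ((dyadicIndex n t + c) / 2 ^ n)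
        (1 / 16 / 2 ^ n)) ≠ 0 := fun h => hn (by rw [h, ENNReal.zero_div])
    obtain ⟨u, huD, hu⟩ := nonempty_of_measure_ne_zero hne
    have hp : (0 : ℝ) < 2 ^ n := by positivity
    refine ⟨u, huD, ?_⟩
    rwa [Metric.mem_closedBall, Real.dist_eq, show u - (dyadicIndex n t + c) / 2 ^ n =
      (2 ^ n * u - (dyadicIndex n t + c)) / 2 ^ n by field_simp, abs_div, abs_of_pos hp,
      div_le_div_iff_of_pos_right hp] at hu
  obtain ⟨n, ⟨u, huD, hu⟩, ⟨v, hvD, hv⟩, hn⟩ := ((hnear (1 / 8) (by norm_num)).and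
    ((hnear (7 / 8) (by norm_num)).and
      (htop.eventually_gt_atTop (3 * C / ‖K.b - K.a‖)))).exists
  have hi := dyadicIndex_lt n t
  have hlen := K.edgeLength_dyadicIndex n ht
  have hp : (0 : ℝ) < 2 ^ n := by positivity
  set i := dyadicIndex n t
  rw [abs_le] at hu hv
  have hpow : (2 : ℝ) ^ (n + 2) = 2 ^ n * 4 := by rw [pow_add]; norm_num
  have hpow' : 2 ^ (n + 2) = 2 ^ n * 4 := by rw [pow_add]; norm_num
  -- `u` and `v` lie in the first and the last quarter of the dyadic interval of `t`.
  have hui : dyadicIndex (n + 2) u = i * 2 ^ 2 :=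
    dyadicIndex_eq_of_lt (by omega) (by rw [hpow]; push_cast; linarith)
      (by rw [hpow]; push_cast; linarith)
  have hvi : dyadicIndex (n + 2) v = i * 2 ^ 2 + 3 :=
    dyadicIndex_eq_of_lt (by omega) (by rw [hpow]; push_cast; linarith)
      (by rw [hpow]; push_cast; linarith)
  have hlen2 : ∀ j < 2 ^ (n + 2), j / 2 / 2 = i →
      K.edgeLength (n + 2) j ≤ K.edgeLength n i * (51 / 100) * (51 / 100) := fun j hj hji => by
    have h1 := K.edgeLength_succ_le (n + 1) j hj
    have h2 := K.edgeLength_succ_le n (j / 2) (by rw [pow_succ]; omega)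
    rw [hji] at h2
    linarith
  have hFu := K.kochMap_mem_cap (n + 2) (hD huD)
  have hFv := K.kochMap_mem_cap (n + 2) (hD hvD)
  rw [hui] at hFu
  rw [hvi] at hFv
  have e1 := K.norm_sub_edge_fst_le _ _ (by omega) hFu
  have e2 := K.norm_sub_edge_snd_le _ _ (by omega) hFv
  rw [K.edge_mul_two_pow_fst] at e1
  rw [K.edge_succ_odd (n + 1) _ (by omega), K.edge_succ_odd n _ (by omega),
    show (i * 2 ^ 2 + 3) / 2 / 2 = i by omega] at e2
  dsimp only at e2
  have e3 := hlen2 _ (by omega) (show i * 2 ^ 2 / 2 / 2 = i by omega)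
  have e4 := hlen2 _ (by omega) (show (i * 2 ^ 2 + 3) / 2 / 2 = i by omega)
  have e5 : K.edgeLength n i ≤ ‖K.kochMap v - (K.edge n i).2‖ + ‖K.kochMap v - K.kochMap u‖ +
      ‖K.kochMap u - (K.edge n i).1‖ := by
    rw [norm_sub_rev (K.kochMap v) (K.edge n i).2]
    refine le_trans (le_of_eq ?_) ((norm_add_le _ _).trans (add_le_add_left (norm_add_le _ _) _))
    rw [edgeLength]
    congr 1
    ring
  have e6 : ‖K.kochMap v - K.kochMap u‖ ≤ C / 2 ^ n := by
    rw [← dist_eq_norm]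
    refine (hC.dist_le_mul v hvD u huD).trans ?_
    rw [div_eq_mul_inv]
    refine mul_le_mul_of_nonneg_left ?_ C.2
    rw [Real.dist_eq, ← one_div, le_div_iff₀ hp, abs_eq_max_neg, max_mul_of_nonneg _ _ hp.le]
    exact max_le (by linarith) (by linarith)
  have e7 : K.edgeLength n i ≤ 3 * C / 2 ^ n := by
    rw [mul_div_assoc]
    linarith [K.edgeLength_nonneg n i, e1.trans e3, e2.trans e4]
  rw [hlen, div_mul_eq_mul_div, div_le_div_iff_of_pos_right hp] at e7
  rw [div_lt_iff₀ hL] at hn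
  linarith

/-- The inverse of the parametrization extends to a Lipschitz function on the plane. -/
theorem exists_lipschitzWith_leftInvOn : ∃ (C : NNReal) (h : ℂ → ℝ), LipschitzWith C h ∧
    LeftInvOn h K.kochMap (Icc 0 1) := by
  have hinv := K.injOn_kochMap.leftInvOn_invFunOn
  have hlip : LipschitzOnWith (Real.toNNReal (30 / ‖K.b - K.a‖))
      (Function.invFunOn K.kochMap (Icc 0 1)) (K.kochMap '' Icc 0 1) := by
    refine LipschitzOnWith.of_dist_le_mul ?_
    rintro _ ⟨s, hs, rfl⟩ _ ⟨t, ht, rfl⟩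
    rw [hinv hs, hinv ht, Real.coe_toNNReal _ (by positivity)]
    exact K.dist_le_kochMap hs ht
  obtain ⟨h, hh, heq⟩ := hlip.extend_real
  exact ⟨_, h, hh, fun t ht => (heq (mem_image_of_mem _ ht)).symm.trans (hinv ht)⟩

/-- A Lipschitz curve meets the image of the set of parameters with infinite stretch product in
a set with null preimage. -/
theorem volume_stretch_atTop_inter_range_eq_zero {C : NNReal} {G : ℝ → ℂ}
    (hG : LipschitzWith C G) : volume {t ∈ Icc (0 : ℝ) 1 | K.kochMap t ∈ range G ∧
      Tendsto (fun N => K.stretch N (K.kochMap t)) atTop atTop} = 0 := by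
  obtain ⟨C', h, hh, hinv⟩ := K.exists_lipschitzWith_leftInvOn
  obtain ⟨S, hS0, hS⟩ := (hh.comp hG).exists_antilipschitzWith_restrict
  have hD : ∀ p, volume {t ∈ {t ∈ Icc (0 : ℝ) 1 | ∃ s ∈ S p, G s = K.kochMap t} |
      Tendsto (fun N => K.stretch N (K.kochMap t)) atTop atTop} = 0 := fun p => by
    obtain ⟨k, hk⟩ := hS p
    refine K.volume_stretch_atTop_eq_zero (fun t ht => ht.1) (C := C * k)
      (LipschitzOnWith.of_dist_le_mul ?_)
    rintro t ⟨ht, s, hs, hst⟩ t' ⟨ht', s', hs', hst'⟩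
    have h1 := hG.dist_le_mul s s'
    have h2 := hk.le_mul_dist ⟨s, hs⟩ ⟨s', hs'⟩
    rw [hst, hst'] at h1
    rw [Subtype.dist_eq, domRestrict_apply, domRestrict_apply, Function.comp_apply,
      Function.comp_apply, hst, hst', hinv ht, hinv ht'] at h2
    rw [NNReal.coe_mul, mul_assoc]
    exact h1.trans (mul_le_mul_of_nonneg_left h2 C.2)
  refine measure_mono_null ?_ (measure_union_null hS0 (measure_iUnion_null hD))
  rintro t ⟨ht, ⟨s, hs⟩, htop⟩
  by_cases hsS : s ∈ ⋃ p, S p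
  · obtain ⟨p, hp⟩ := mem_iUnion.1 hsS
    exact Or.inr (mem_iUnion.2 ⟨p, ⟨ht, s, hp, hs⟩, htop⟩)
  · exact Or.inl ⟨s, hsS, by rw [Function.comp_apply, hs, hinv ht]⟩

/-! ### Rectifiability of Koch type sets -/

theorem IsKochTypeSet.subset_limitSet {K : KochConstruction} {A : Set ℂ}
    (hA : K.IsKochTypeSet A) : A ⊆ K.limitSet := by
  rcases hA with rfl | rfl
  · exact Subset.rfl
  · exact sdiff_subset

theorem IsKochTypeSet.limitSet_diff_edgePoints_subset {K : KochConstruction} {A : Set ℂ}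
    (hA : K.IsKochTypeSet A) : K.limitSet \ K.edgePoints ⊆ A := by
  rcases hA with rfl | rfl
  · exact sdiff_subset
  · exact Subset.rfl

theorem countable_edgePoints : K.edgePoints.Countable :=
  countable_iUnion fun n => (Finset.countable_toSet _).biUnion fun i _ => by
    have : (K.vertices n i).Finite := by simp [vertices]
    exact this.countable

theorem hausdorffMeasure_lambdaInfPreimage (A : Set ℂ) :
    Measure.hausdorffMeasure 1 (K.lambdaInfPreimage A) =
      nndist K.a K.b • volume {t : ℝ | t ∈ Icc (0 : ℝ) 1 ∧ K.kochMap t ∈ K.lambdaInf A} := by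
  rw [lambdaInfPreimage, hausdorffMeasure_lineMap_image, hausdorffMeasure_real]

theorem hausdorffMeasure_lambdaInfPreimage_eq_zero_iff (A : Set ℂ) :
    Measure.hausdorffMeasure 1 (K.lambdaInfPreimage A) = 0 ↔
      volume {t : ℝ | t ∈ Icc (0 : ℝ) 1 ∧ K.kochMap t ∈ K.lambdaInf A} = 0 := by
  rw [hausdorffMeasure_lambdaInfPreimage, ENNReal.smul_def, smul_eq_mul, mul_eq_zero,
    or_iff_right]
  simpa using K.a_ne_b

theorem countablyOneRectifiable_of_lambdaInf_null {A : Set ℂ} (hA : K.IsKochTypeSet A)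
    (h : Measure.hausdorffMeasure 1 (K.lambdaInf A) = 0) : CountablyOneRectifiable A := by
  choose C hC using K.lipschitzOnWith_kochMap
  choose F hF heq using fun M => (hC M).extend_finite_dimension
  refine ⟨K.lambdaInf A, F, h, fun j => ⟨_, hF j⟩, fun x hx => ?_⟩
  by_cases hxΛ : x ∈ K.lambdaInf A
  · exact Or.inl hxΛ
  · obtain ⟨t, ht, rfl⟩ := K.exists_kochMap_eq (hA.subset_limitSet hx)
    obtain ⟨M, hM⟩ := K.exists_stretch_le fun h => hxΛ ⟨hx, h⟩
    exact Or.inr (mem_iUnion.2 ⟨M, t, (heq M ⟨ht, hM⟩).symm⟩)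

theorem lambdaInfPreimage_null_of_countablyOneRectifiable {A : Set ℂ}
    (h : CountablyOneRectifiable A) :
    Measure.hausdorffMeasure 1 (K.lambdaInfPreimage A) = 0 := by
  rw [hausdorffMeasure_lambdaInfPreimage_eq_zero_iff]
  obtain ⟨M₀, G, hM₀, hG, hsub⟩ := h
  choose C hC using hG
  obtain ⟨C', h, hh, hinv⟩ := K.exists_lipschitzWith_leftInvOn
  have h0 : volume (h '' M₀) = 0 := by
    have := hh.hausdorffMeasure_image_le zero_le_one M₀
    rw [hM₀, mul_zero, hausdorffMeasure_real] at this
    exact le_antisymm this zero_le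
  refine measure_mono_null ?_ (measure_union_null h0 (measure_iUnion_null fun j =>
    K.volume_stretch_atTop_inter_range_eq_zero (hC j)))
  rintro t ⟨ht, htA, htop⟩
  rcases hsub htA with hM | hj
  · exact Or.inl ⟨_, hM, hinv ht⟩
  · obtain ⟨j, hj⟩ := mem_iUnion.1 hj
    exact Or.inr (mem_iUnion.2 ⟨j, ht, hj, htop⟩)

/-- If the angles depend on the level only, the stretch product is the same at all points, so that
`Λ_∞` is empty or all of `A`; the preimage of `A` has full measure. -/
theorem lambdaInf_eq_empty_of_preimage_null {A : Set ℂ} (hA : K.IsKochTypeSet A)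
    (hK : K.IsAEpsilonType) (h : Measure.hausdorffMeasure 1 (K.lambdaInfPreimage A) = 0) :
    K.lambdaInf A = ∅ := by
  rw [hausdorffMeasure_lambdaInfPreimage_eq_zero_iff] at h
  refine eq_empty_of_forall_notMem fun x hx => ?_
  have hstretch : ∀ y N, K.stretch N y = K.stretch N x := fun y N =>
    Finset.prod_congr rfl fun n _ => by
      rw [hK n _ _ (K.capIndex_lt n y) (K.capIndex_lt n x)]
  have hE : volume (Icc (0 : ℝ) 1 ∩ K.kochMap ⁻¹' K.edgePoints) = 0 := by
    refine Countable.measure_zero ?_ _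
    exact MapsTo.countable_of_injOn (f := K.kochMap) (fun t ht => ht.2)
      (K.injOn_kochMap.mono inter_subset_left) K.countable_edgePoints
  have hIcc : volume (Icc (0 : ℝ) 1) = 0 := by
    refine measure_mono_null (fun t ht => ?_) (measure_union_null hE h)
    by_cases htE : K.kochMap t ∈ K.edgePoints
    · exact Or.inl ⟨ht, htE⟩
    · refine Or.inr ⟨ht, hA.limitSet_diff_edgePoints_subset
        ⟨K.kochMap_mem_limitSet ht, htE⟩, ?_⟩
      simp only [hstretch (K.kochMap t)]
      exact hx.2
  simp at hIcc

end KochConstruction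

theorem corollary9 (K : KochConstruction) (A : Set ℂ) (hA : K.IsKochTypeSet A) :
    (MeasureTheory.Measure.hausdorffMeasure 1 (K.lambdaInf A) = 0 →
      CountablyOneRectifiable A) ∧
    (0 < MeasureTheory.Measure.hausdorffMeasure 1 (K.lambdaInfPreimage A) →
      ¬ CountablyOneRectifiable A) ∧
    (K.IsAEpsilonType →
      (CountablyOneRectifiable A ↔
        MeasureTheory.Measure.hausdorffMeasure 1 (K.lambdaInfPreimage A) = 0)) := by
  refine ⟨K.countablyOneRectifiable_of_lambdaInf_null hA, fun h hrect =>
    h.ne' (K.lambdaInfPreimage_null_of_countablyOneRectifiable hrect), fun hK =>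
    ⟨K.lambdaInfPreimage_null_of_countablyOneRectifiable, fun h =>
      K.countablyOneRectifiable_of_lambdaInf_null hA ?_⟩⟩
  rw [K.lambdaInf_eq_empty_of_preimage_null hA hK h, measure_empty]
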